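/- Let $0<\alpha<2$ and put $\alpha_1=\alpha/2$. Let $S$ be a probability density function of the mixing distribution of the sub-Gaussian $\alpha$-stable (SG$\alpha$S) distribution, that is, of the totally skewed stable distribution on $\mathbb{R}$ with shape $\alpha_1$, skewness $1$, scale $\gamma=\cos(\pi\alpha/4)^{2/\alpha}$ and location $0$, whose characteristic function is $$\theta\mapsto\exp\left(-\gamma^{\alpha_1}|\theta|^{\alpha_1}\left[1-\mathrm{i}\tan\left(\tfrac{\pi\alpha_1}{2}\right)\operatorname{sign}\theta\right]\right).$$ Let $m\ge 0$ be an integer, let $\eta>0$, and for $y>0$ let $$q'(y)=y^{-m/2}\exp\left(-\frac{\eta}{2y}\right)S(y).$$ For $a,b>0$ let $\mathrm{IG}(y;a,b)=\frac{b^a}{\Gamma(a)}y^{-a-1}e^{-b/y}$, $y>0$, denote the inverse-Gamma density, and for $\xi=1,2,\dots$ put $$a_\xi=\xi\alpha_1+\frac m2,\qquad b=\frac\eta2,\qquad c_\xi=(-1)^{\xi+1}\,\frac{\Gamma(\xi\alpha_1+1)}{\pi\,\xi!}\,\sin(\xi\alpha_1\pi).$$ Then $$q'(y)=\sum_{\xi=1}^{\infty}c_\xi\,\frac{\Gamma(a_\xi)}{b^{a_\xi}}\,\mathrm{IG}(y;a_\xi,b),$$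 the series converging absolutely, for almost every $y>0$ and for every $y>0$ at which $S$ is continuous; in particular for every $y>0$ when $S$ is the continuous version of the density. -/

import Mathlib

open MeasureTheory ProbabilityTheory

noncomputable section

/-- The characteristic function `θ ↦ E (exp (i θ x))` of the univariate stable distribution with
shape (stability) parameter `α`, skewness `β`, scale `γ` and location `δ`. -/
def stableCharFun (α β γ δ θ : ℝ) : ℂ :=
  if α = 1 then
    Complex.exp (-((γ * |θ| : ℝ) : ℂ) *
        (1 + Complex.I * ((β * (2 / Real.pi) * Real.sign θ * Real.log |θ| : ℝ) : ℂ))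
      + Complex.I * ((δ * θ : ℝ) : ℂ))
  else
    Complex.exp (-((γ ^ α * |θ| ^ α : ℝ) : ℂ) *
        (1 - Complex.I * ((β * Real.tan (Real.pi * α / 2) * Real.sign θ : ℝ) : ℂ))
      + Complex.I * ((δ * θ : ℝ) : ℂ))

/-- `S` is a probability density function, with respect to Lebesgue measure on `ℝ`, of the
univariate stable distribution with parameters `α`, `β`, `γ`, `δ`. -/
structure IsStablePDF (α β γ δ : ℝ) (S : ℝ → ℝ) : Prop where
  measurable : Measurable S
  nonneg : ∀ y, 0 ≤ S y
  isProbabilityMeasure :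
    IsProbabilityMeasure ((volume : Measure ℝ).withDensity fun y => ENNReal.ofReal (S y))
  charFun_eq : ∀ θ : ℝ,
    charFun ((volume : Measure ℝ).withDensity fun y => ENNReal.ofReal (S y)) θ =
      stableCharFun α β γ δ θ

/-- `S` is a mixing density of the sub-Gaussian `α`-stable distribution: a density of the totally
skewed stable distribution with shape `α / 2` and scale `cos (π α / 4) ^ (2 / α)`, the scale for
which the Laplace transform is `s ↦ exp (-s ^ (α / 2))`. -/
def IsSubGaussianStableMixingPDF (α : ℝ) (S : ℝ → ℝ) : Prop :=
  IsStablePDF (α / 2) 1 (Real.cos (Real.pi * α / 4) ^ (2 / α)) 0 S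

/-- The inverse-Gamma density with shape `a` and scale `b`. -/
def inverseGammaPDFReal (a b y : ℝ) : ℝ :=
  if 0 < y then b ^ a / Real.Gamma a * y ^ (-a - 1) * Real.exp (-b / y) else 0

/-- The unnormalised density `q'(y) = y ^ (-m / 2) exp (-η / (2 y)) S(y)`. -/
def unnormalisedPosterior (m : ℕ) (η : ℝ) (S : ℝ → ℝ) (y : ℝ) : ℝ :=
  y ^ (-(m : ℝ) / 2) * Real.exp (-η / (2 * y)) * S y

/-- The shape `a_ξ = ξ α₁ + m / 2`. -/
def seriesShape (α₁ : ℝ) (m ξ : ℕ) : ℝ :=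
  ξ * α₁ + (m : ℝ) / 2

/-- The coefficient `c_ξ = (-1) ^ (ξ + 1) Γ(ξ α₁ + 1) sin (ξ α₁ π) / (π ξ!)`. -/
def seriesCoeff (α₁ : ℝ) (ξ : ℕ) : ℝ :=
  (-1) ^ (ξ + 1) * (Real.Gamma (ξ * α₁ + 1) / (Real.pi * (Nat.factorial ξ : ℝ))) *
    Real.sin (ξ * α₁ * Real.pi)

/-- The term of index `ξ` of the inverse-Gamma series,
`c_ξ Γ(a_ξ) / b ^ a_ξ IG(y; a_ξ, b)`. -/
def inverseGammaSeriesTerm (α₁ : ℝ) (m : ℕ) (b y : ℝ) (ξ : ℕ) : ℝ :=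
  seriesCoeff α₁ ξ * (Real.Gamma (seriesShape α₁ m ξ) / b ^ seriesShape α₁ m ξ) *
    inverseGammaPDFReal (seriesShape α₁ m ξ) b y

end

/-! Multiplying `y ^ (-ξ α₁ - 1)` by `y ^ (-m / 2) exp (-η / (2 y))` gives an inverse-Gamma kernel,
so the claim reduces to `S y = ∑ c_ξ y ^ (-ξ α₁ - 1)`. For `θ > 0` the characteristic function is
`exp (-w θ ^ α₁)` with `w = exp (-iπα/4)`. Since `0 < re w` it is integrable, and Fourier inversion
with conjugate symmetry gives `S y = π⁻¹ re ∫ exp (-iyθ) exp (-w θ ^ α₁)` over `θ > 0`, almost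
everywhere and at continuity points. Expanding `exp (-w θ ^ α₁)` leaves powers of `θ`, not
integrable against `exp (-iyθ)`. The expansion is therefore made against `exp (-zθ)` with `0 < re
z`, and then `z` tends to `iy`. Convergence rests on `Γ(kα₁ + 1) ≤ k! ^ α₁` with `α₁ < 1`. In `ℝ`,
`HasSum` includes absolute convergence. -/

open Filter Set Topology FourierTransform ContDiff in
/-- Fourier inversion almost everywhere, for integrable functions with integrable Fourier
transform. -/
theorem MeasureTheory.Integrable.fourierInv_fourier_ae_eq {f : ℝ → ℂ} (hf : Integrable f)
    (hf' : Integrable (𝓕 f)) : 𝓕⁻ (𝓕 f) =ᵐ[volume] f := by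
  have flip : ∀ u v : ℝ → ℂ, Integrable u → Integrable v →
      ∫ x, 𝓕 u x • v x = ∫ x, u x • 𝓕 v x := fun u v hu hv => by
    simpa using! VectorFourier.integral_fourierIntegral_smul_eq_flip (L := innerₗ ℝ)
      Real.continuous_fourierChar continuous_inner hu hv
  have hcont : Continuous (𝓕⁻ (𝓕 f)) := by
    rw [Real.fourierInv_eq_fourier_comp_neg]
    exact VectorFourier.fourierIntegral_continuous Real.continuous_fourierChar
      continuous_inner hf'.comp_neg
  -- Against a test function, `flip` moves both transforms onto a Schwartz function, where inversion
  -- is known.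
  refine ae_eq_of_integral_contDiff_smul_eq hcont.locallyIntegrable hf.locallyIntegrable ?_
  intro g g_smooth g_cpt
  have hg₁ : HasCompactSupport (Complex.ofRealCLM ∘ g) := g_cpt.comp_left rfl
  have hg₂ : ContDiff ℝ ∞ (Complex.ofRealCLM ∘ g) := by fun_prop
  let G : SchwartzMap ℝ ℂ := hg₁.toSchwartzMap hg₂
  have hG : ∀ x, G x = (g x : ℂ) := fun x => rfl
  calc ∫ x, g x • 𝓕⁻ (𝓕 f) x = ∫ x, 𝓕 (fun x => 𝓕 f (-x)) x • G x := by
        simp [Real.fourierInv_eq_fourier_comp_neg, hG, mul_comm]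
    _ = ∫ x, 𝓕 f (-x) • 𝓕 (G : ℝ → ℂ) x := flip _ _ hf'.comp_neg G.integrable
    _ = ∫ x, 𝓕 f x • 𝓕 (G : ℝ → ℂ) (-x) := by
        rw [← integral_neg_eq_self]; simp
    _ = ∫ x, 𝓕 f x • (𝓕⁻ G : SchwartzMap ℝ ℂ) x := by
        simp [SchwartzMap.fourierInv_coe, Real.fourierInv_eq_fourier_neg]
    _ = ∫ x, f x • 𝓕 ((𝓕⁻ G : SchwartzMap ℝ ℂ) : ℝ → ℂ) x :=
        flip _ _ hf (SchwartzMap.integrable _)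
    _ = ∫ x, g x • f x := by
        rw [← SchwartzMap.fourier_coe, FourierTransform.fourier_fourierInv_eq]
        simp [hG, mul_comm]

/-! ### Termwise Laplace and Fourier integrals -/

open Set Filter Topology in
/-- The Laplace transform of a power function, on the right half plane. -/
theorem integral_rpow_mul_cexp_neg_mul_Ioi {a : ℝ} (ha : 0 < a) {r : ℂ} (hr : 0 < r.re) :
    ∫ t : ℝ in Ioi 0, ((t ^ (a - 1) : ℝ) : ℂ) * Complex.exp (-(r * t)) =
      r ^ (-(a : ℂ)) * (Real.Gamma a : ℂ) := by
  -- As a complex moment generating function the integral is analytic in `z = -r`; the identity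
  -- theorem extends the real Gamma integral from the negative axis.
  let μ : Measure ℝ := (volume.restrict (Ioi 0)).withDensity fun t => ENNReal.ofReal (t ^ (a - 1))
  have hmeas : Measurable fun t : ℝ => ENNReal.ofReal (t ^ (a - 1)) := by fun_prop
  have hμ : ∀ z : ℂ, complexMGF id μ z =
      ∫ t : ℝ in Ioi 0, ((t ^ (a - 1) : ℝ) : ℂ) * Complex.exp (z * t) := fun z => by
    rw [complexMGF, integral_withDensity_eq_integral_toReal_smul hmeas (by simp)]
    refine setIntegral_congr_fun measurableSet_Ioi fun t (ht : 0 < t) => ?_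
    simp only [id]
    rw [ENNReal.toReal_ofReal (by positivity), Complex.real_smul]
  have hsub : Iio 0 ⊆ interior (integrableExpSet id μ) := by
    refine interior_maximal (fun x (hx : x < 0) => ?_) isOpen_Iio
    change Integrable _ _
    rw [integrable_withDensity_iff_integrable_smul' hmeas (by simp)]
    have := integrableOn_rpow_mul_exp_neg_mul_rpow (s := a - 1) (p := 1) (b := -x)
      (by linarith) one_pos (by linarith)
    refine IntegrableOn.congr_fun this (fun t (ht : 0 < t) => ?_) measurableSet_Ioi
    simp only [id]
    rw [ENNReal.toReal_ofReal (by positivity)]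
    simp
  have hU : Convex ℝ {z : ℂ | z.re < 0} := convex_halfSpace_re_lt 0
  have h1 : AnalyticOnNhd ℂ (complexMGF id μ) {z | z.re < 0} :=
    analyticOnNhd_complexMGF.mono fun z hz => hsub hz
  have h2 : AnalyticOnNhd ℂ (fun z : ℂ => (-z) ^ (-(a : ℂ)) * (Real.Gamma a : ℂ))
      {z | z.re < 0} := fun z (hz : z.re < 0) => by
    refine AnalyticAt.mul (AnalyticAt.cpow (by fun_prop) (by fun_prop) (Or.inl ?_)) (by fun_prop)
    simpa using hz
  have key := h1.eqOn_of_preconnected_of_frequently_eq h2 hU.isPreconnected (z₀ := ((-1 : ℝ) : ℂ))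
    (by simp) ?_
  · have := key (show (-r) ∈ {z : ℂ | z.re < 0} by simpa using hr)
    simpa [hμ, neg_mul] using this
  · have ht : Tendsto (fun x : ℝ => (x : ℂ)) (𝓝[≠] (-1)) (𝓝[≠] ((-1 : ℝ) : ℂ)) := by
      refine tendsto_nhdsWithin_iff.2 ⟨?_, ?_⟩
      · exact (Complex.continuous_ofReal.tendsto _).mono_left nhdsWithin_le_nhds
      · filter_upwards [self_mem_nhdsWithin] with x hx
        simpa only [mem_compl_iff, mem_singleton_iff, Complex.ofReal_inj] using hx
    refine ht.frequently (Eventually.frequently ?_)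
    filter_upwards [nhdsWithin_le_nhds (Iio_mem_nhds (show (-1 : ℝ) < 0 by norm_num))]
      with x (hx : x < 0)
    have := Real.integral_rpow_mul_exp_neg_mul_Ioi ha (neg_pos.2 hx)
    rw [hμ]
    rw [one_div, Real.inv_rpow (by linarith), ← Real.rpow_neg (by linarith)] at this
    have h3 := congrArg (fun x : ℝ => (x : ℂ)) this
    simp only [← integral_complex_ofReal] at h3
    push_cast [Complex.ofReal_cpow (neg_nonneg.2 hx.le)] at h3 ⊢
    simpa using h3

/-- `Γ(k β + 1) / k!` decays faster than any geometric sequence when `β < 1`. -/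
theorem summable_gamma_div_factorial {β : ℝ} (h0 : 0 < β) (h1 : β < 1) {x : ℝ} (hx : 0 < x) :
    Summable fun k : ℕ => Real.Gamma (k * β + 1) / (Nat.factorial k : ℝ) * x ^ k := by
  have hs : Summable fun k : ℕ => (Nat.factorial k : ℝ) ^ (β - 1) * x ^ k := by
    refine summable_of_ratio_test_tendsto_lt_one zero_lt_one
      (Filter.Eventually.of_forall fun k => by positivity) ?_
    have ht : Filter.Tendsto (fun k : ℕ => ((k : ℝ) + 1) ^ (-(1 - β)) * x) Filter.atTop
        (nhds (0 * x)) :=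
      ((tendsto_rpow_neg_atTop (sub_pos.2 h1)).comp
        (Filter.tendsto_atTop_add_const_right _ 1 tendsto_natCast_atTop_atTop)).mul_const x
    rw [zero_mul] at ht
    refine ht.congr fun k => ?_
    rw [Real.norm_of_nonneg (by positivity), Real.norm_of_nonneg (by positivity),
      Nat.factorial_succ, Nat.cast_mul, Real.mul_rpow (by positivity) (by positivity), neg_sub,
      pow_succ]
    push_cast
    field_simp
  refine Summable.of_nonneg_of_le (fun k => ?_) (fun k => ?_) hs
  · have := Real.Gamma_pos_of_pos (show 0 < (k : ℝ) * β + 1 by positivity)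
    positivity
  · gcongr
    -- Log-convexity of `Γ` between `1` and `k + 1`, with weights `1 - β` and `β`.
    have := Real.Gamma_mul_add_mul_le_rpow_Gamma_mul_rpow_Gamma (s := 1) (t := k + 1)
      one_pos (by positivity) (sub_pos.2 h1) h0 (by ring)
    rw [Real.Gamma_one, Real.one_rpow, one_mul, Real.Gamma_nat_eq_factorial,
      show (1 - β) * 1 + β * ((k : ℝ) + 1) = k * β + 1 by ring] at this
    rwa [Real.rpow_sub_one (by positivity), div_le_div_iff_of_pos_right (by positivity)]

open Set in
/-- Term by term Laplace transform of `exp (-w t ^ β)` on the right half plane. -/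
theorem hasSum_laplace_cexp_neg_rpow {β : ℝ} (h0 : 0 < β) (h1 : β < 1) (w : ℂ) (hw : w ≠ 0)
    {z : ℂ} (hz : 0 < z.re) :
    HasSum (fun k : ℕ => (-w) ^ k / (Nat.factorial k : ℂ) *
        (z ^ (-((k * β + 1 : ℝ) : ℂ)) * (Real.Gamma (k * β + 1) : ℂ)))
      (∫ t : ℝ in Ioi 0, Complex.exp (-(((t ^ β : ℝ) : ℂ) * w)) * Complex.exp (-(z * t))) := by
  have hpos : ∀ k : ℕ, 0 < (k : ℝ) * β + 1 := fun k => by positivity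
  let F : ℕ → ℝ → ℂ := fun k t => (-w) ^ k / (Nat.factorial k : ℂ) *
    (((t ^ ((k * β + 1 : ℝ) - 1) : ℝ) : ℂ) * Complex.exp (-(z * t)))
  have hnorm : ∀ k, ∀ t ∈ Ioi (0 : ℝ), ‖F k t‖ = ‖w‖ ^ k / (Nat.factorial k : ℝ) *
      (t ^ ((k * β + 1 : ℝ) - 1) * Real.exp (-(z.re * t))) := fun k t (ht : 0 < t) => by
    simp only [F, norm_mul, norm_div, norm_pow, norm_neg, Complex.norm_exp, Complex.norm_real,
      Complex.norm_natCast]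
    rw [Real.norm_of_nonneg (by positivity)]
    simp
  have hint : ∀ k, IntegrableOn (F k) (Ioi 0) := fun k => by
    have hm : AEStronglyMeasurable (F k) (volume.restrict (Ioi 0)) :=
      Measurable.aestronglyMeasurable (by fun_prop)
    rw [IntegrableOn, ← integrable_norm_iff hm]
    refine IntegrableOn.congr_fun ?_ (fun t ht => (hnorm k t ht).symm) measurableSet_Ioi
    have := integrableOn_rpow_mul_exp_neg_mul_rpow (s := (k * β + 1 : ℝ) - 1) (p := 1)
      (b := z.re) (by linarith [hpos k]) one_pos hz
    simpa using! this.const_mul (‖w‖ ^ k / (Nat.factorial k : ℝ))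
  have hsum : Summable fun k => ∫ t in Ioi 0, ‖F k t‖ := by
    have hx : 0 < ‖w‖ * (1 / z.re) ^ β := by have := norm_pos_iff.2 hw; positivity
    refine ((summable_gamma_div_factorial h0 h1 hx).mul_left (1 / z.re)).congr fun k => ?_
    rw [setIntegral_congr_fun measurableSet_Ioi (hnorm k), integral_const_mul,
      Real.integral_rpow_mul_exp_neg_mul_Ioi (hpos k) hz, Real.rpow_add_one (by positivity),
      mul_comm (k : ℝ) β, Real.rpow_mul (by positivity), Real.rpow_natCast]
    ring
  have key := hasSum_integral_of_summable_integral_norm hint hsum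
  convert! key using 1
  · funext k
    simp only [F]
    rw [integral_const_mul, integral_rpow_mul_cexp_neg_mul_Ioi (hpos k) hz]
  · refine setIntegral_congr_fun measurableSet_Ioi fun t (ht : 0 < t) => ?_
    simp only [F, add_sub_cancel_right]
    rw [Complex.exp_eq_exp_ℂ, NormedSpace.exp_eq_tsum_div]
    simp only
    rw [← tsum_mul_right]
    refine tsum_congr fun k => ?_
    rw [mul_comm (k : ℝ) β, Real.rpow_mul ht.le, Real.rpow_natCast, ← mul_neg, mul_pow]
    push_cast
    ring

open Set Filter Topology in
/-- The expansion of `hasSum_laplace_cexp_neg_rpow` persists on the imaginary axis when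
`0 < re w`. -/
theorem hasSum_fourier_cexp_neg_rpow {β : ℝ} (h0 : 0 < β) (h1 : β < 1) {w : ℂ} (hw : 0 < w.re)
    {y : ℝ} (hy : 0 < y) :
    HasSum (fun k : ℕ => (-w) ^ k / (Nat.factorial k : ℂ) *
        ((Complex.I * y) ^ (-((k * β + 1 : ℝ) : ℂ)) * (Real.Gamma (k * β + 1) : ℂ)))
      (∫ t : ℝ in Ioi 0,
        Complex.exp (-(((t ^ β : ℝ) : ℂ) * w)) * Complex.exp (-(Complex.I * y * t))) := by
  have hw0 : w ≠ 0 := by rintro rfl; simp at hw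
  let T : ℂ → ℕ → ℂ := fun z k => (-w) ^ k / (Nat.factorial k : ℂ) *
        (z ^ (-((k * β + 1 : ℝ) : ℂ)) * (Real.Gamma (k * β + 1) : ℂ))
  let G : ℂ → ℝ → ℂ := fun z t =>
    Complex.exp (-(((t ^ β : ℝ) : ℂ) * w)) * Complex.exp (-(z * t))
  let Z : ℝ → ℂ := fun ε => ε + Complex.I * y
  have hZ : Tendsto Z (𝓝[>] 0) (𝓝 (Complex.I * y)) := by
    have : Continuous Z := by fun_prop
    simpa [Z] using (this.tendsto 0).mono_left nhdsWithin_le_nhds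
  -- This majorant is uniform in `ε`, because `‖Z ε‖ ≥ |im (Z ε)| = y`.
  let B : ℕ → ℝ := fun k => ‖w‖ ^ k / (Nat.factorial k : ℝ) *
    (y ^ (-(k * β + 1)) * Real.Gamma (k * β + 1))
  have hB : Summable B := by
    have hx : 0 < ‖w‖ * y ^ (-β) := by have := norm_pos_iff.2 hw0; positivity
    refine ((summable_gamma_div_factorial h0 h1 hx).mul_left y⁻¹).congr fun k => ?_
    simp only [B]
    rw [neg_add, ← sub_eq_add_neg, Real.rpow_sub_one hy.ne', ← mul_neg, mul_comm (k : ℝ) (-β),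
      Real.rpow_mul hy.le, Real.rpow_natCast]
    ring
  have hbound : ∀ z : ℂ, y ≤ ‖z‖ → ∀ k, ‖T z k‖ ≤ B k := fun z hz k => by
    have hp : 0 < (k : ℝ) * β + 1 := by positivity
    have hΓ := Real.Gamma_pos_of_pos hp
    simp only [T, B, norm_mul, norm_div, norm_pow, norm_neg, Complex.norm_natCast]
    rw [← Complex.ofReal_neg, Complex.norm_cpow_real, Complex.norm_real,
      Real.norm_of_nonneg hΓ.le]
    have := Real.rpow_le_rpow_of_nonpos hy hz (neg_nonpos.2 hp.le)
    gcongr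
  have hlim1 : Tendsto (fun ε => ∑' k, T (Z ε) k) (𝓝[>] 0) (𝓝 (∑' k, T (Complex.I * y) k)) := by
    refine tendsto_tsum_of_dominated_convergence hB (fun k => ?_) ?_
    · refine Tendsto.const_mul _ (Tendsto.mul_const _ ?_)
      have : ContinuousAt (fun z : ℂ => z ^ (-((k * β + 1 : ℝ) : ℂ))) (Complex.I * y) :=
        continuousAt_cpow_const (Or.inr (by simpa using hy.ne'))
      exact this.tendsto.comp hZ
    · filter_upwards with ε
      refine hbound _ ?_
      have := Complex.abs_im_le_norm (Z ε)
      simpa [Z, abs_of_pos hy] using this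
  have hlim2 : Tendsto (fun ε => ∫ t in Ioi 0, G (Z ε) t) (𝓝[>] 0)
      (𝓝 (∫ t in Ioi 0, G (Complex.I * y) t)) := by
    -- Here `0 < re w` is essential: it supplies an integrable majorant after the damping `exp (-ε
    -- t)` is lost.
    refine tendsto_integral_filter_of_dominated_convergence
      (fun t => Real.exp (-w.re * t ^ β)) ?_ ?_ ?_ ?_
    · exact Eventually.of_forall fun ε => Measurable.aestronglyMeasurable (by fun_prop)
    · filter_upwards [self_mem_nhdsWithin] with ε (hε : 0 < ε)
      filter_upwards [ae_restrict_mem measurableSet_Ioi] with t (ht : 0 < t)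
      simp only [G, norm_mul, Complex.norm_exp]
      rw [← Real.exp_add, Real.exp_le_exp]
      have : 0 < ε * t := by positivity
      simp [Z]
      nlinarith
    · simpa using! integrableOn_rpow_mul_exp_neg_mul_rpow (s := 0) (by norm_num) h0 hw
    · refine Eventually.of_forall fun t => ?_
      have : Continuous fun z => G z t := by fun_prop
      exact (this.tendsto _).comp hZ
  have heq : ∑' k, T (Complex.I * y) k = ∫ t in Ioi 0, G (Complex.I * y) t := by
    refine tendsto_nhds_unique (hlim1.congr' ?_) hlim2
    filter_upwards [self_mem_nhdsWithin] with ε (hε : 0 < ε)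
    exact (hasSum_laplace_cexp_neg_rpow h0 h1 w hw0 (by simpa [Z] using hε)).tsum_eq
  have hs : Summable (T (Complex.I * y)) :=
    Summable.of_norm_bounded hB (hbound _ (by simp [abs_of_pos hy]))
  exact heq ▸ hs.hasSum

/-! ### The characteristic function of the mixing law -/

/-- The scale raised to `α / 2` is `cos (π α / 4)`, which turns the tangent into a sine and leaves a
unimodular coefficient of `|θ| ^ (α / 2)`. -/
theorem stableCharFun_mixing {α : ℝ} (h0 : 0 < α) (h2 : α < 2) (θ : ℝ) :
    stableCharFun (α / 2) 1 (Real.cos (Real.pi * α / 4) ^ (2 / α)) 0 θ =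
      Complex.exp (-(((|θ| ^ (α / 2) : ℝ) : ℂ) *
        ((Real.cos (Real.pi * α / 4) : ℂ) -
          Complex.I * ((Real.sign θ * Real.sin (Real.pi * α / 4) : ℝ) : ℂ)))) := by
  have hπ := Real.pi_pos
  have hc : 0 < Real.cos (Real.pi * α / 4) :=
    Real.cos_pos_of_mem_Ioo ⟨by nlinarith, by nlinarith⟩
  have hγ : (Real.cos (Real.pi * α / 4) ^ (2 / α)) ^ (α / 2) = Real.cos (Real.pi * α / 4) := by
    rw [← Real.rpow_mul hc.le, show 2 / α * (α / 2) = 1 by field_simp, Real.rpow_one]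
  have htan : Real.cos (Real.pi * α / 4) * Real.tan (Real.pi * (α / 2) / 2) =
      Real.sin (Real.pi * α / 4) := by
    rw [show Real.pi * (α / 2) / 2 = Real.pi * α / 4 by ring, mul_comm, Real.tan_mul_cos hc.ne']
  rw [stableCharFun, if_neg (by linarith), hγ, ← htan]
  congr 1
  push_cast
  ring

theorem norm_stableCharFun_mixing {α : ℝ} (h0 : 0 < α) (h2 : α < 2) (θ : ℝ) :
    ‖stableCharFun (α / 2) 1 (Real.cos (Real.pi * α / 4) ^ (2 / α)) 0 θ‖ =
      Real.exp (-Real.cos (Real.pi * α / 4) * |θ| ^ (α / 2)) := by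
  rw [stableCharFun_mixing h0 h2, Complex.norm_exp, Complex.neg_re, Complex.re_ofReal_mul]
  simp [mul_comm, -Complex.ofReal_sin, -Complex.ofReal_cos]

theorem stableCharFun_mixing_neg {α : ℝ} (h0 : 0 < α) (h2 : α < 2) (θ : ℝ) :
    stableCharFun (α / 2) 1 (Real.cos (Real.pi * α / 4) ^ (2 / α)) 0 (-θ) =
      (starRingEnd ℂ)
        (stableCharFun (α / 2) 1 (Real.cos (Real.pi * α / 4) ^ (2 / α)) 0 θ) := by
  rw [stableCharFun_mixing h0 h2, stableCharFun_mixing h0 h2, ← Complex.exp_conj]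
  congr 1
  rw [abs_neg, Real.sign_neg]
  simp [-Complex.ofReal_sin, -Complex.ofReal_cos]

theorem measurable_stableCharFun_mixing {α : ℝ} (h0 : 0 < α) (h2 : α < 2) :
    Measurable (stableCharFun (α / 2) 1 (Real.cos (Real.pi * α / 4) ^ (2 / α)) 0) := by
  rw [funext (stableCharFun_mixing h0 h2)]
  have : Measurable Real.sign :=
    Measurable.ite measurableSet_Iio measurable_const
      (Measurable.ite measurableSet_Ioi measurable_const measurable_const)
  fun_prop

theorem integrable_stableCharFun_mixing {α : ℝ} (h0 : 0 < α) (h2 : α < 2) :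
    Integrable (stableCharFun (α / 2) 1 (Real.cos (Real.pi * α / 4) ^ (2 / α)) 0) := by
  have hc : 0 < Real.cos (Real.pi * α / 4) := by
    have hπ := Real.pi_pos
    exact Real.cos_pos_of_mem_Ioo ⟨by nlinarith, by nlinarith⟩
  rw [← integrable_norm_iff (measurable_stableCharFun_mixing h0 h2).aestronglyMeasurable]
  simp only [norm_stableCharFun_mixing h0 h2]
  -- A non-integrable function has integral `0` by convention, so a nonzero closed form suffices.
  refine Integrable.of_integral_ne_zero ?_
  rw [integral_comp_abs (f := fun x => Real.exp (-Real.cos (Real.pi * α / 4) * x ^ (α / 2))),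
    integral_exp_neg_mul_rpow (by positivity) hc]
  have := Real.Gamma_pos_of_pos (show 0 < 1 / (α / 2) + 1 by positivity)
  positivity

open Set in
/-- The Fourier inversion integral of the mixing distribution, as a series. -/
theorem hasSum_integral_stableCharFun_mixing {α : ℝ} (h0 : 0 < α) (h2 : α < 2) {y : ℝ}
    (hy : 0 < y) :
    HasSum (fun n : ℕ => seriesCoeff (α / 2) (n + 1) * y ^ (-(((n + 1 : ℕ) : ℝ) * (α / 2)) - 1))
      ((2 * Real.pi)⁻¹ * (∫ θ : ℝ, Complex.exp (-(Complex.I * y * θ)) *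
        stableCharFun (α / 2) 1 (Real.cos (Real.pi * α / 4) ^ (2 / α)) 0 θ).re) := by
  have hπ := Real.pi_pos
  have hc : 0 < Real.cos (Real.pi * α / 4) :=
    Real.cos_pos_of_mem_Ioo ⟨by nlinarith, by nlinarith⟩
  set φ := stableCharFun (α / 2) 1 (Real.cos (Real.pi * α / 4) ^ (2 / α)) 0 with hφ
  let w : ℂ := Complex.exp (-((Real.pi * α / 4 : ℝ) : ℂ) * Complex.I)
  have hw : w = (Real.cos (Real.pi * α / 4) : ℂ) -
      Complex.I * (Real.sin (Real.pi * α / 4) : ℂ) := by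
    simp only [w]
    rw [Complex.exp_mul_I, Complex.cos_neg, Complex.sin_neg]
    push_cast
    ring
  have hwre : 0 < w.re := by
    rw [hw]; simpa [-Complex.ofReal_sin, -Complex.ofReal_cos] using hc
  let g : ℝ → ℂ := fun θ => Complex.exp (-(Complex.I * y * θ)) * φ θ
  have hg : Integrable g := by
    refine (integrable_stableCharFun_mixing h0 h2).bdd_mul (c := 1)
      (Measurable.aestronglyMeasurable (by fun_prop)) (Filter.Eventually.of_forall fun θ => ?_)
    rw [Complex.norm_exp]
    simp
  have hgneg : ∀ θ, g (-θ) = (starRingEnd ℂ) (g θ) := fun θ => by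
    simp only [g, hφ]
    rw [stableCharFun_mixing_neg h0 h2, map_mul, ← Complex.exp_conj]
    congr 2
    simp
  have hsplit : (∫ θ, g θ).re = 2 * (∫ θ in Ioi 0, g θ).re := by
    have h1 : ∫ θ, g θ = (∫ θ in Ioi 0, g (-θ)) + ∫ θ in Ioi 0, g θ := by
      rw [integral_comp_neg_Ioi, neg_zero, intervalIntegral.integral_Iic_add_Ioi
        hg.integrableOn hg.integrableOn]
    simp only [h1, hgneg, integral_conj, Complex.add_re, Complex.conj_re]
    ring
  have hIoi : ∫ θ in Ioi 0, g θ = ∫ t : ℝ in Ioi 0, Complex.exp (-(((t ^ (α / 2) : ℝ) : ℂ) * w)) *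
      Complex.exp (-(Complex.I * y * t)) := by
    refine setIntegral_congr_fun measurableSet_Ioi fun t (ht : 0 < t) => ?_
    simp only [g, hφ]
    rw [stableCharFun_mixing h0 h2, abs_of_pos ht, Real.sign_of_pos ht, one_mul, ← hw, mul_comm]
  have key := hasSum_fourier_cexp_neg_rpow (half_pos h0) (by linarith : α / 2 < 1) hwre hy
  rw [← hIoi] at key
  -- The phases of `w ^ k` and `(iy) ^ (-kα/2 - 1)` add up to `-(kπα/2 + π/2)`, whose cosine is
  -- `-sin (kπα/2)`.
  have hterm : ∀ k : ℕ, ((-w) ^ k / (Nat.factorial k : ℂ) * ((Complex.I * y) ^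
      (-((k * (α / 2) + 1 : ℝ) : ℂ)) * (Real.Gamma (k * (α / 2) + 1) : ℂ))).re =
      Real.pi * (seriesCoeff (α / 2) k * y ^ (-((k : ℝ) * (α / 2)) - 1)) := fun k => by
    have hI : (Complex.I * y) ^ (-((k * (α / 2) + 1 : ℝ) : ℂ)) =
        ((y ^ (-((k : ℝ) * (α / 2)) - 1) : ℝ) : ℂ) *
          Complex.exp (((-(Real.pi / 2 * (k * (α / 2) + 1)) : ℝ) : ℂ) * Complex.I) := by
      rw [mul_comm Complex.I, Complex.cpow_def_of_ne_zero (by simp [hy.ne']),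
        Complex.log_ofReal_mul hy Complex.I_ne_zero, Complex.log_I, Real.rpow_def_of_pos hy,
        Complex.ofReal_exp, ← Complex.exp_add]
      congr 1
      push_cast
      ring
    have hwk : w ^ k = Complex.exp (((-(Real.pi * α / 4 * k) : ℝ) : ℂ) * Complex.I) := by
      simp only [w]
      rw [← Complex.exp_nat_mul]
      congr 1
      push_cast
      ring
    have hang : w ^ k * Complex.exp (((-(Real.pi / 2 * (k * (α / 2) + 1)) : ℝ) : ℂ) * Complex.I) =
        Complex.exp (((-(k * (α / 2) * Real.pi + Real.pi / 2) : ℝ) : ℂ) * Complex.I) := by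
      rw [hwk, ← Complex.exp_add]
      congr 1
      push_cast
      ring
    have hall : (-w) ^ k / (Nat.factorial k : ℂ) * ((Complex.I * y) ^
        (-((k * (α / 2) + 1 : ℝ) : ℂ)) * (Real.Gamma (k * (α / 2) + 1) : ℂ)) =
        (((-1) ^ k / (Nat.factorial k : ℝ) * y ^ (-((k : ℝ) * (α / 2)) - 1) *
          Real.Gamma (k * (α / 2) + 1) : ℝ) : ℂ) *
        Complex.exp (((-(k * (α / 2) * Real.pi + Real.pi / 2) : ℝ) : ℂ) * Complex.I) := by
      rw [← hang, hI, neg_pow]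
      push_cast
      ring
    rw [hall, Complex.re_ofReal_mul, Complex.exp_ofReal_mul_I_re, Real.cos_neg,
      Real.cos_add_pi_div_two, seriesCoeff, pow_succ]
    field_simp
  have hre := (Complex.hasSum_re key).mul_left Real.pi⁻¹
  simp only [hterm, inv_mul_cancel_left₀ hπ.ne'] at hre
  -- The sine kills the term `k = 0`, so the series starts at `1`.
  have hzero : seriesCoeff (α / 2) 0 * y ^ (-(((0 : ℕ) : ℝ) * (α / 2)) - 1) = 0 := by
    simp [seriesCoeff]
  rw [← hasSum_nat_add_iff' 1] at hre
  rw [Finset.sum_range_one, hzero, sub_zero] at hre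
  rw [hsplit]
  convert! hre using 1
  field_simp

/-! ### Fourier inversion for the density -/

theorem IsStablePDF.integrable {α β γ δ : ℝ} {S : ℝ → ℝ} (hS : IsStablePDF α β γ δ S) :
    Integrable S := by
  refine ⟨hS.measurable.aestronglyMeasurable, ?_⟩
  rw [hasFiniteIntegral_iff_ofReal (Filter.Eventually.of_forall hS.nonneg)]
  have := hS.isProbabilityMeasure.measure_univ
  rw [withDensity_apply _ MeasurableSet.univ, Measure.restrict_univ] at this
  simp [this]

open FourierTransform in
theorem IsStablePDF.fourier_eq {α β γ δ : ℝ} {S : ℝ → ℝ} (hS : IsStablePDF α β γ δ S) (u : ℝ) :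
    𝓕 (fun y => (S y : ℂ)) u = stableCharFun α β γ δ (-2 * Real.pi * u) := by
  rw [← hS.charFun_eq, charFun_apply_real,
    integral_withDensity_eq_integral_toReal_smul hS.measurable.ennreal_ofReal (by simp),
    Real.fourier_real_eq_integral_exp_smul]
  congr 1 with y
  rw [ENNReal.toReal_ofReal (hS.nonneg y), Complex.real_smul, smul_eq_mul, mul_comm]
  congr 2
  push_cast
  ring

-- Substitution `θ = -2πu`, reconciling the kernel `exp (2πiuy)` with the probabilists' convention.
open FourierTransform in
theorem fourierInv_comp_mul (φ : ℝ → ℂ) (y : ℝ) :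
    𝓕⁻ (fun u => φ (-2 * Real.pi * u)) y =
      ((2 * Real.pi)⁻¹ : ℝ) • ∫ θ : ℝ, Complex.exp (-(Complex.I * y * θ)) * φ θ := by
  have h := Measure.integral_comp_mul_left
    (fun θ : ℝ => Complex.exp (-(Complex.I * y * θ)) * φ θ) (-2 * Real.pi)
  have h2 : |(-2 * Real.pi)⁻¹| = (2 * Real.pi)⁻¹ := by
    rw [abs_inv, neg_mul, abs_neg, abs_of_pos Real.two_pi_pos]
  rw [h2] at h
  rw [← h, Real.fourierInv_eq']
  congr 1 with u
  rw [smul_eq_mul]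
  congr 2
  simp
  ring

open FourierTransform in
/-- The density of the mixing distribution, as a series. -/
theorem IsSubGaussianStableMixingPDF.hasSum {α : ℝ} (h0 : 0 < α) (h2 : α < 2) {S : ℝ → ℝ}
    (hS : IsSubGaussianStableMixingPDF α S) :
    Integrable (fun y => (S y : ℂ)) ∧ Integrable (𝓕 fun y => (S y : ℂ)) ∧
    ∀ y, 0 < y → 𝓕⁻ (𝓕 fun y => (S y : ℂ)) y = (S y : ℂ) →
      HasSum (fun n : ℕ =>
        seriesCoeff (α / 2) (n + 1) * y ^ (-(((n + 1 : ℕ) : ℝ) * (α / 2)) - 1)) (S y) := by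
  have hF : (𝓕 fun y => (S y : ℂ)) = fun u => stableCharFun (α / 2) 1
      (Real.cos (Real.pi * α / 4) ^ (2 / α)) 0 (-2 * Real.pi * u) :=
    funext (IsStablePDF.fourier_eq hS)
  refine ⟨(IsStablePDF.integrable hS).ofReal, ?_, fun y hy h => ?_⟩
  · rw [hF]
    exact (integrable_stableCharFun_mixing h0 h2).comp_mul_left' (by simp [Real.pi_ne_zero])
  · have key := hasSum_integral_stableCharFun_mixing h0 h2 hy
    rw [hF, fourierInv_comp_mul] at h
    have := congrArg Complex.re h
    rw [Complex.smul_re, Complex.ofReal_re, smul_eq_mul] at this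
    rwa [this] at key

/-! ### The inverse-Gamma series -/

theorem inverseGammaSeriesTerm_eq {α₁ : ℝ} (hα₁ : 0 < α₁) (m : ℕ) {η y : ℝ} (hη : 0 < η)
    (hy : 0 < y) (n : ℕ) :
    inverseGammaSeriesTerm α₁ m (η / 2) y (n + 1) =
      y ^ (-(m : ℝ) / 2) * Real.exp (-η / (2 * y)) *
        (seriesCoeff α₁ (n + 1) * y ^ (-(((n + 1 : ℕ) : ℝ) * α₁) - 1)) := by
  have ha : 0 < seriesShape α₁ m (n + 1) := by unfold seriesShape; positivity
  have hΓ := Real.Gamma_pos_of_pos ha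
  have hb : 0 < (η / 2) ^ seriesShape α₁ m (n + 1) := by positivity
  have hpow : y ^ (-seriesShape α₁ m (n + 1) - 1) =
      y ^ (-(m : ℝ) / 2) * y ^ (-(((n + 1 : ℕ) : ℝ) * α₁) - 1) := by
    rw [← Real.rpow_add hy, seriesShape]
    congr 1
    ring
  have hexp : -(η / 2) / y = -η / (2 * y) := by field_simp
  rw [inverseGammaSeriesTerm, inverseGammaPDFReal, if_pos hy, hpow, hexp]
  field_simp

/-- The sums over `ξ = 1, 2, …` are indexed by `n = ξ - 1 : ℕ`. -/
theorem lemma1 (α : ℝ) (hα₀ : 0 < α) (hα₂ : α < 2) (m : ℕ) (η : ℝ) (hη : 0 < η)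
    (S : ℝ → ℝ) (hS : IsSubGaussianStableMixingPDF α S) :
    (∀ᵐ y ∂((volume : Measure ℝ).restrict (Set.Ioi 0)),
      HasSum (fun n : ℕ => inverseGammaSeriesTerm (α / 2) m (η / 2) y (n + 1))
        (unnormalisedPosterior m η S y)) ∧
    (∀ y : ℝ, 0 < y → ContinuousAt S y →
      HasSum (fun n : ℕ => inverseGammaSeriesTerm (α / 2) m (η / 2) y (n + 1))
        (unnormalisedPosterior m η S y)) := by
  obtain ⟨hf, hf', hsum⟩ := hS.hasSum hα₀ hα₂
  have hposterior : ∀ y, 0 < y → HasSum (fun n : ℕ =>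
      seriesCoeff (α / 2) (n + 1) * y ^ (-(((n + 1 : ℕ) : ℝ) * (α / 2)) - 1)) (S y) →
      HasSum (fun n : ℕ => inverseGammaSeriesTerm (α / 2) m (η / 2) y (n + 1))
        (unnormalisedPosterior m η S y) := fun y hy h => by
    simp only [inverseGammaSeriesTerm_eq (half_pos hα₀) m hη hy]
    exact h.mul_left _
  -- The two claims differ only in which inversion theorem recovers `S y`.
  refine ⟨?_, fun y hy hc => hposterior y hy (hsum y hy ?_)⟩
  · filter_upwards [ae_restrict_of_ae (hf.fourierInv_fourier_ae_eq hf'),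
      ae_restrict_mem measurableSet_Ioi] with y h hy
    exact hposterior y hy (hsum y hy h)
  · exact hf.fourierInv_fourier_eq hf' (Complex.continuous_ofReal.continuousAt.comp hc)
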